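/- Identify $\mathbb{R}^2=\mathbb{R}\oplus i\mathbb{R}$ with its standard symplectic form $dx\wedge dy$, write $\mathbb{R}$ for the real axis and let $I=\mathrm{diag}(1,-1)$. For a continuous path $\Lambda:[a,b]\to\mathrm{Lag}(\mathbb{R}^2)$ of lines and a line $V$, let $\mu_{\rm RS}(\Lambda,V)\in\frac12\mathbb{Z}$ be the Robbin-Salamon index: after a homotopy with fixed end points to a $C^1$ path having only regular crossings with $V$, it is the sum of the signatures of the crossing forms over all crossings, where crossings at $a$ and $b$ are counted with the factor $\frac12$ (counterclockwise rotation counts positively). Let $T>0$ and let $\Psi:\mathbb{R}\to\mathrm{Sp}(\mathbb{R}^2)$ be a continuous path with $\Psi(0)=\mathbb{1}$, $\Psi(t+T)=\Psi(t)\Psi(T)$ and $\Psi(-t)=I\Psi(t)I$ for all $t\in\mathbb{R}$. Then: 1. If $\mu_{\rm RS}(\Psi|_{[0,\frac T2]}\mathbb{R},\mathbb{R})\ge\frac32$, then $\mu_{\rm RS}(\Psi|_{[0,\frac{mT}{2}]}\mathbb{R},\mathbb{R})\ge\frac{2m+1}{2}$ for every integer $m\ge1$. 2. If $\mu_{\rm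 RS}(\Psi|_{[0,\frac T2]}\mathbb{R},\mathbb{R})\ge\frac12$, then $\mu_{\rm RS}(\Psi|_{[0,\frac{mT}{2}]}\mathbb{R},\mathbb{R})\ge\frac12$ for every integer $m\ge1$. 3. If $\mu_{\rm RS}(\Psi|_{[0,\frac T2]}\mathbb{R},\mathbb{R})<\frac12$, then $\mu_{\rm RS}(\Psi|_{[0,\frac{mT}{2}]}\mathbb{R},\mathbb{R})<\frac12$ for every integer $m\ge1$. -/

import Mathlib

namespace RSIndex

/-- The plane `ℝ² = ℝ ⊕ iℝ`: the coordinate `Sum.inl 0` is `x` and `Sum.inr 0` is `y`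
(the indexing that Mathlib's `Matrix.symplecticGroup (Fin 1) ℝ = Sp(ℝ²)` acts on). -/
abbrev Plane : Type := Fin 1 ⊕ Fin 1 → ℝ

/-- The standard symplectic form `dx ∧ dy`. -/
def omega (v w : Plane) : ℝ :=
  v (Sum.inl 0) * w (Sum.inr 0) - v (Sum.inr 0) * w (Sum.inl 0)

/-- The real axis `ℝ ⊂ ℝ²`. -/
def realAxis : Submodule ℝ Plane := Submodule.span ℝ {Pi.single (Sum.inl 0) 1}

/-- The reflection `I = diag(1, -1)`, that is, complex conjugation. -/
def conjMatrix : Matrix (Fin 1 ⊕ Fin 1) (Fin 1 ⊕ Fin 1) ℝ := Matrix.fromBlocks 1 0 0 (-1)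

/-- The path of subspaces `t ↦ Ψ(t) L`. -/
def movedLine (Ψ : ℝ → Matrix.symplecticGroup (Fin 1) ℝ) (L : Submodule ℝ Plane) (t : ℝ) :
    Submodule ℝ Plane :=
  L.map (Matrix.toLin' (Ψ t : Matrix (Fin 1 ⊕ Fin 1) (Fin 1 ⊕ Fin 1) ℝ))

/-- `Λ` is, on `S`, a family of lines (the Lagrangian subspaces of the plane) that is spanned by
a continuous nowhere vanishing vector field. It is used for `S` an interval or a rectangle, where,
the tautological line bundle pulled back to `S` being trivial, this says exactly that
`Λ : S → Lag(ℝ²)` is continuous. -/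
def IsContinuousLineFamily {X : Type*} [TopologicalSpace X]
    (Λ : X → Submodule ℝ Plane) (S : Set X) : Prop :=
  ∃ u : X → Plane, ContinuousOn u S ∧ ∀ x ∈ S, u x ≠ 0 ∧ Λ x = Submodule.span ℝ {u x}

/-- Two paths of lines on `[a, b]` are homotopic through continuous paths of lines with the same
end points. -/
def HomotopicRelEnds (Λ₀ Λ₁ : ℝ → Submodule ℝ Plane) (a b : ℝ) : Prop :=
  ∃ H : ℝ × ℝ → Submodule ℝ Plane,
    IsContinuousLineFamily H (Set.Icc 0 1 ×ˢ Set.Icc a b) ∧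
    (∀ t ∈ Set.Icc a b, H (0, t) = Λ₀ t ∧ H (1, t) = Λ₁ t) ∧
    ∀ s ∈ Set.Icc (0 : ℝ) 1, H (s, a) = Λ₀ a ∧ H (s, b) = Λ₀ b

/-- For the path of lines `Λ(t) = ℝ u(t)`, the value at the vector `u(t)` of the quadratic form
`Q(Λ(t), Λ'(t))` on `Λ(t)`; its value at `ξ u(t)` is `ξ ^ 2` times this number. When
`Λ(t) = V`, i.e. `t` is a crossing, this is the crossing form, and its signature is the sign of
this number. -/
noncomputable def crossingForm (u : ℝ → Plane) (a b t : ℝ) : ℝ :=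
  omega (u t) (derivWithin u (Set.Icc a b) t)

/-- The vector field `u` spans a `C¹` path of lines on `[a, b]` all of whose crossings with the
line `V` are regular, that is, have a nondegenerate crossing form. -/
def HasRegularCrossings (u : ℝ → Plane) (V : Submodule ℝ Plane) (a b : ℝ) : Prop :=
  ContDiffOn ℝ 1 u (Set.Icc a b) ∧ (∀ t ∈ Set.Icc a b, u t ≠ 0) ∧
    ∀ t ∈ Set.Icc a b, u t ∈ V → crossingForm u a b t ≠ 0

open Classical in
/-- The sum of the signatures of the crossing forms over all crossings (finitely many, if they are
regular), where crossings at the two ends of the interval count with the factor `1 / 2`. -/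
noncomputable def crossingSum (u : ℝ → Plane) (V : Submodule ℝ Plane) (a b : ℝ) : ℝ :=
  ∑ᶠ t ∈ {t : ℝ | t ∈ Set.Icc a b ∧ u t ∈ V},
    (if t = a ∨ t = b then (1 / 2 : ℝ) else 1) * Real.sign (crossingForm u a b t)

/-- `μ` is the Robbin-Salamon index of the path of lines `Λ` on `[a, b]` relative to the line `V`:
the crossing sum of some `C¹` path with only regular crossings which is homotopic to `Λ` with
fixed end points. -/
def IsRSIndex (Λ : ℝ → Submodule ℝ Plane) (V : Submodule ℝ Plane) (a b μ : ℝ) : Prop :=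
  ∃ u : ℝ → Plane, HasRegularCrossings u V a b ∧
    HomotopicRelEnds Λ (fun t => Submodule.span ℝ {u t}) a b ∧ μ = crossingSum u V a b

open Classical in
/-- The Robbin-Salamon index `μ_RS(Λ|[a,b], V)` of a path of lines (`0` if `Λ` has none). -/
noncomputable def rsIndex (Λ : ℝ → Submodule ℝ Plane) (V : Submodule ℝ Plane) (a b : ℝ) : ℝ :=
  if h : ∃ μ : ℝ, IsRSIndex Λ V a b μ then h.choose else 0

end RSIndex

namespace RSIndex

open Real Set Topology Filter

/-! A linear isomorphism of the plane acts on directions. Continuity of Ψ and `Ψ 0 = 1` lift this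
action to a family of increasing maps `Φ t : ℝ → ℝ` on angles, with `Φ 0 = id`, each commuting with
translation by π. The index of a path of lines that starts at the real axis depends only on its
final angle θ: it is `halfTurns θ`, and `nat_add_half_le_halfTurns_iff` turns a bound n + 1/2 ≤
index into θ > nπ. All three claims thus become inequalities for `Φ (m * T / 2) 0`.

Put g = `Φ (T / 2)`. The symmetry makes `Φ (-(T / 2))` the map g⁻ : x ↦ -g(-x), and the period
relation gives g = g⁻ ∘ `Φ T`. So `Φ (m * T / 2) 0` arises from 0 by alternately applying g and the
inverse of g⁻ (`half_period_induction`). Both maps are increasing and commute with translation by π.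
If g(0) > π, each raises a lower bound nπ to a strict lower bound (n + 1)π; if g(0) > 0, each sends
nonnegative angles to positive ones; if g(0) ≤ 0, each preserves nonpositive angles.

The index formula rests on `HasRegularCrossings.crossingSum_eq`, where `halfTurns` jumps at each
crossing exactly as the count does, and on lifting a homotopy to angles over a rectangle. -/

theorem plane_ext {v w : Plane} (h₁ : v (Sum.inl 0) = w (Sum.inl 0))
    (h₂ : v (Sum.inr 0) = w (Sum.inr 0)) : v = w := by
  funext i
  rcases i with i | i <;> rw [Subsingleton.elim i 0] <;> assumption

/-! ### Directions and continuous choices of angle -/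

/-- The unit vector of angle `s`. -/
noncomputable def dirVec (s : ℝ) : Plane := Sum.elim (fun _ => cos s) (fun _ => sin s)

@[simp] theorem dirVec_inl (s : ℝ) (i : Fin 1) : dirVec s (Sum.inl i) = cos s := rfl

@[simp] theorem dirVec_inr (s : ℝ) (i : Fin 1) : dirVec s (Sum.inr i) = sin s := rfl

theorem contDiff_dirVec : ContDiff ℝ 1 dirVec := by
  rw [contDiff_pi]
  rintro (i | i)
  · exact contDiff_cos
  · exact contDiff_sin

theorem continuous_dirVec : Continuous dirVec := contDiff_dirVec.continuous

theorem dirVec_ne_zero (s : ℝ) : dirVec s ≠ 0 := by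
  intro h
  have h₁ := congrFun h (Sum.inl 0)
  have h₂ := congrFun h (Sum.inr 0)
  simp only [dirVec_inl, dirVec_inr, Pi.zero_apply] at h₁ h₂
  have := sin_sq_add_cos_sq s
  simp [h₁, h₂] at this

/-- The determinant of two parallel vectors vanishes. Agreement of angles modulo π is expressed
throughout by `sin (a - b) = 0`. -/
theorem sin_sub_eq_zero_of_smul_eq {a b r r' : ℝ} (hr : r ≠ 0) (hr' : r' ≠ 0)
    (h : r • dirVec a = r' • dirVec b) : sin (a - b) = 0 := by
  have h₁ := congrFun h (Sum.inl 0)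
  have h₂ := congrFun h (Sum.inr 0)
  simp only [dirVec_inl, dirVec_inr, Pi.smul_apply, smul_eq_mul] at h₁ h₂
  rw [sin_sub]
  apply mul_left_cancel₀ (mul_ne_zero hr hr')
  linear_combination r' * cos b * h₂ - r' * sin b * h₁

theorem dirVec_add_int_mul_pi (s : ℝ) (k : ℤ) : dirVec (s + k * π) = ((-1 : ℝ) ^ k) • dirVec s := by
  apply plane_ext
  · simp [cos_add_int_mul_pi]
  · simp [sin_add_int_mul_pi]

theorem exists_int_of_sin_sub_eq_zero {a b : ℝ} (h : sin (a - b) = 0) : ∃ k : ℤ, a = b + k * π := by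
  obtain ⟨k, hk⟩ := sin_eq_zero_iff.1 h
  exact ⟨k, by linarith⟩

theorem span_dirVec_eq_iff {a b : ℝ} :
    Submodule.span ℝ {dirVec a} = Submodule.span ℝ {dirVec b} ↔ sin (a - b) = 0 := by
  constructor
  · intro h
    have : dirVec a ∈ Submodule.span ℝ {dirVec b} := h ▸ Submodule.mem_span_singleton_self _
    obtain ⟨c, hc⟩ := Submodule.mem_span_singleton.1 this
    have hc0 : c ≠ 0 := by
      rintro rfl
      exact dirVec_ne_zero a (by simpa using hc.symm)
    exact sin_sub_eq_zero_of_smul_eq one_ne_zero hc0 (by rw [one_smul, hc])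
  · intro h
    obtain ⟨k, rfl⟩ := exists_int_of_sin_sub_eq_zero h
    rw [dirVec_add_int_mul_pi]
    refine Submodule.span_singleton_smul_eq ?_ _
    exact IsUnit.mk0 _ (zpow_ne_zero _ (by norm_num))

theorem span_smul_dirVec {r : ℝ} (hr : 0 < r) (a : ℝ) :
    Submodule.span ℝ {r • dirVec a} = Submodule.span ℝ {dirVec a} :=
  Submodule.span_singleton_smul_eq (IsUnit.mk0 _ hr.ne') _

/-- Two continuous angle functions that agree modulo `π` differ by a constant. -/
theorem angle_sub_const {X : Type*} [TopologicalSpace X] {S : Set X} (hS : IsPreconnected S)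
    {f g : X → ℝ} (hf : ContinuousOn f S) (hg : ContinuousOn g S)
    (h : ∀ x ∈ S, sin (f x - g x) = 0) {x y : X} (hx : x ∈ S) (hy : y ∈ S) :
    f x - g x = f y - g y := by
  refine hS.constant_of_mapsTo (T := (AddSubgroup.zmultiples π : Set ℝ)) (f := fun x => f x - g x)
    ⟨inferInstanceAs (DiscreteTopology (AddSubgroup.zmultiples π))⟩ (hf.sub hg) ?_ hx hy
  intro z hz
  obtain ⟨k, hk⟩ := sin_eq_zero_iff.1 (h z hz)
  exact ⟨k, by simpa using hk⟩

/-- Two continuous angle functions that agree modulo `π`, and agree at one point, are equal. -/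
theorem angle_unique {X : Type*} [TopologicalSpace X] [PreconnectedSpace X]
    {f g : X → ℝ} (hf : Continuous f) (hg : Continuous g)
    (h : ∀ x, sin (f x - g x) = 0) {x : X} (hx : f x = g x) (y : X) : f y = g y := by
  have := angle_sub_const isPreconnected_univ hf.continuousOn hg.continuousOn (fun x _ => h x)
    (mem_univ y) (mem_univ x)
  linarith

/-- A continuous nowhere vanishing planar vector field on a simply connected space has a
continuous angle. -/
theorem exists_angle {X : Type*} [TopologicalSpace X] [SimplyConnectedSpace X]
    [LocallyPathConnectedSpace X] {u : X → Plane} (hu : Continuous u) (h0 : ∀ x, u x ≠ 0)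
    (x₀ : X) {r₀ θ₀ : ℝ} (hr₀ : 0 < r₀) (hx₀ : u x₀ = r₀ • dirVec θ₀) :
    ∃ θ : X → ℝ, Continuous θ ∧ θ x₀ = θ₀ ∧ ∀ x, ∃ r : ℝ, 0 < r ∧ u x = r • dirVec (θ x) := by
  let f : C(X, {z : ℂ // z ≠ 0}) :=
    ⟨fun x => ⟨⟨u x (Sum.inl 0), u x (Sum.inr 0)⟩, fun h => h0 x
      (plane_ext (congrArg Complex.re h) (congrArg Complex.im h))⟩, by
      refine Continuous.subtype_mk ?_ _
      have : (fun x => (⟨u x (Sum.inl 0), u x (Sum.inr 0)⟩ : ℂ)) =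
          fun x => ((u x (Sum.inl 0) : ℝ) : ℂ) + ((u x (Sum.inr 0) : ℝ) : ℂ) * Complex.I := by
        funext x
        apply Complex.ext <;> simp
      rw [this]
      fun_prop⟩
  -- Lift the field through the covering exp : ℂ → ℂ \ {0}, starting at log r₀ + iθ₀; the imaginary
  -- part of the lift is the angle.
  obtain ⟨F, ⟨hF₀, hF⟩, -⟩ := Complex.isCoveringMap_exp.existsUnique_continuousMap_lifts f x₀
    (⟨Real.log r₀, θ₀⟩ : ℂ) (by
      apply Subtype.ext
      apply Complex.ext
      · simp [f, Complex.exp_re, Real.exp_log hr₀, hx₀]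
      · simp [f, Complex.exp_im, Real.exp_log hr₀, hx₀])
  refine ⟨fun x => (F x).im, Complex.continuous_im.comp F.continuous, by simp [hF₀], fun x =>
    ⟨Real.exp (F x).re, Real.exp_pos _, ?_⟩⟩
  have hx : Complex.exp (F x) = ⟨u x (Sum.inl 0), u x (Sum.inr 0)⟩ :=
    congrArg Subtype.val (congrFun hF x)
  apply plane_ext
  · simpa [Complex.exp_re] using (congrArg Complex.re hx).symm
  · simpa [Complex.exp_im] using (congrArg Complex.im hx).symm

theorem exists_polar {v : Plane} (hv : v ≠ 0) : ∃ r θ : ℝ, 0 < r ∧ v = r • dirVec θ := by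
  have hz : (⟨v (Sum.inl 0), v (Sum.inr 0)⟩ : ℂ) ≠ 0 := fun h =>
    hv (plane_ext (congrArg Complex.re h) (congrArg Complex.im h))
  refine ⟨_, Complex.arg ⟨v (Sum.inl 0), v (Sum.inr 0)⟩, norm_pos_iff.2 hz, ?_⟩
  apply plane_ext
  · simp [Complex.norm_mul_cos_arg]
  · simp [Complex.norm_mul_sin_arg]

/-! ### The lifted action of Ψ on angles -/

/-- `Φ t s` is the angle, continuous in `t` and `s` and equal to `s` at `t = 0`, of the image under
`Ψ t` of the unit vector of angle `s`. -/
structure IsAngleLift (Ψ : ℝ → Matrix.symplecticGroup (Fin 1) ℝ) (Φ : ℝ → ℝ → ℝ) : Prop where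
  continuous : Continuous fun p : ℝ × ℝ => Φ p.1 p.2
  zero : ∀ s, Φ 0 s = s
  image : ∀ t s, ∃ r : ℝ, 0 < r ∧
    (Ψ t : Matrix (Fin 1 ⊕ Fin 1) (Fin 1 ⊕ Fin 1) ℝ).mulVec (dirVec s) = r • dirVec (Φ t s)

theorem mulVec_injective (A : Matrix.symplecticGroup (Fin 1) ℝ) :
    Function.Injective (A : Matrix (Fin 1 ⊕ Fin 1) (Fin 1 ⊕ Fin 1) ℝ).mulVec :=
  Matrix.mulVec_injective_iff_isUnit.2
    ((Matrix.isUnit_iff_isUnit_det _).2 (SymplecticGroup.symplectic_det A.2))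

theorem exists_angleLift {Ψ : ℝ → Matrix.symplecticGroup (Fin 1) ℝ} (hcont : Continuous Ψ)
    (h_one : Ψ 0 = 1) : ∃ Φ, IsAngleLift Ψ Φ := by
  obtain ⟨θ, hθ, hθ0, h⟩ := exists_angle (X := ℝ × ℝ) (u := fun p =>
    (Ψ p.1 : Matrix (Fin 1 ⊕ Fin 1) (Fin 1 ⊕ Fin 1) ℝ).mulVec (dirVec p.2))
    ((continuous_subtype_val.comp (hcont.comp continuous_fst)).matrix_mulVec
      (continuous_dirVec.comp continuous_snd))
    (fun p hp => dirVec_ne_zero p.2 (mulVec_injective (Ψ p.1) (by simpa using hp)))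
    (0, 0) (θ₀ := 0) one_pos (by simp [h_one])
  refine ⟨fun t s => θ (t, s), hθ, ?_, fun t s => h (t, s)⟩
  -- Only the value at (0, 0) was prescribed; uniqueness of lifts in `s` gives `Φ 0 = id`.
  refine angle_unique (by fun_prop) continuous_id (fun s => ?_) (x := 0) hθ0
  obtain ⟨r, hr, hs⟩ := h (0, s)
  simp only [h_one, OneMemClass.coe_one, Matrix.one_mulVec] at hs
  exact sin_sub_eq_zero_of_smul_eq hr.ne' one_ne_zero (by rw [one_smul, hs])

namespace IsAngleLift

variable {Ψ : ℝ → Matrix.symplecticGroup (Fin 1) ℝ} {Φ : ℝ → ℝ → ℝ}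

theorem continuous_left (h : IsAngleLift Ψ Φ) (s : ℝ) : Continuous fun t => Φ t s :=
  h.continuous.comp (by fun_prop : Continuous fun t : ℝ => (t, s))

theorem continuous_right (h : IsAngleLift Ψ Φ) (t : ℝ) : Continuous (Φ t) :=
  h.continuous.comp (by fun_prop : Continuous fun s : ℝ => (t, s))

theorem sin_sub_image {s s' r r' t : ℝ} (h : IsAngleLift Ψ Φ) (hr : r ≠ 0) (hr' : r' ≠ 0)
    (hs : r • dirVec s = r' • dirVec s') : sin (Φ t s - Φ t s') = 0 := by
  obtain ⟨ρ, hρ, h₁⟩ := h.image t s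
  obtain ⟨ρ', hρ', h₂⟩ := h.image t s'
  refine sin_sub_eq_zero_of_smul_eq (mul_ne_zero hr hρ.ne') (mul_ne_zero hr' hρ'.ne') ?_
  rw [mul_smul, mul_smul, ← h₁, ← h₂, ← Matrix.mulVec_smul, ← Matrix.mulVec_smul, hs]

/-- Opposite vectors have opposite images, so both sides agree modulo π for every t, and they are
equal at t = 0. -/
theorem add_int_mul_pi (h : IsAngleLift Ψ Φ) (t s : ℝ) (k : ℤ) :
    Φ t (s + k * π) = Φ t s + k * π := by
  refine angle_unique (h.continuous_left _) ((h.continuous_left s).add continuous_const)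
    (fun t => ?_) (x := 0) (by simp [h.zero]) t
  change sin (_ - (Φ t s + k * π)) = 0
  have := h.sin_sub_image (t := t) one_ne_zero (zpow_ne_zero k (by norm_num : (-1 : ℝ) ≠ 0))
    ((one_smul ℝ _).trans (dirVec_add_int_mul_pi s k))
  rw [← sub_sub, sin_sub_int_mul_pi, this, mul_zero]

theorem int_mul_pi (h : IsAngleLift Ψ Φ) (t : ℝ) (k : ℤ) : Φ t (k * π) = Φ t 0 + k * π := by
  simpa using h.add_int_mul_pi t 0 k

theorem injective (h : IsAngleLift Ψ Φ) (t : ℝ) : Function.Injective (Φ t) := by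
  intro s s' hs
  obtain ⟨ρ, hρ, h₁⟩ := h.image t s
  obtain ⟨ρ', hρ', h₂⟩ := h.image t s'
  have : ρ' • dirVec s = ρ • dirVec s' := by
    apply mulVec_injective (Ψ t)
    rw [Matrix.mulVec_smul, Matrix.mulVec_smul, h₁, h₂, hs, smul_smul, smul_smul, mul_comm]
  obtain ⟨k, rfl⟩ := exists_int_of_sin_sub_eq_zero
    (sin_sub_eq_zero_of_smul_eq hρ'.ne' hρ.ne' this)
  rw [h.add_int_mul_pi] at hs
  linarith

/-- A continuous injection of ℝ is strictly monotone, and commuting with translation by π excludes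
the decreasing case. -/
theorem strictMono (h : IsAngleLift Ψ Φ) (t : ℝ) : StrictMono (Φ t) := by
  rcases (h.continuous_right t).strictMono_of_inj (h.injective t) with hm | hm
  · exact hm
  · have h₁ := hm pi_pos
    have h₂ := h.int_mul_pi t 1
    rw [Int.cast_one, one_mul] at h₂
    have := pi_pos
    linarith

theorem add_period (h : IsAngleLift Ψ Φ) {T : ℝ} (h_period : ∀ t : ℝ, Ψ (t + T) = Ψ t * Ψ T)
    (t s : ℝ) : Φ (t + T) s = Φ t (Φ T s) := by
  refine angle_unique (f := fun t => Φ (t + T) s) ((h.continuous_left s).comp (by fun_prop))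
    (h.continuous_left _) (fun t => ?_) (x := 0) (by simp [h.zero]) t
  obtain ⟨r, hr, h₁⟩ := h.image (t + T) s
  obtain ⟨r₂, hr₂, h₂⟩ := h.image T s
  obtain ⟨r₃, hr₃, h₃⟩ := h.image t (Φ T s)
  refine sin_sub_eq_zero_of_smul_eq hr.ne' (mul_ne_zero hr₂.ne' hr₃.ne') ?_
  rw [← h₁, h_period, Submonoid.coe_mul, ← Matrix.mulVec_mulVec, h₂, Matrix.mulVec_smul, h₃,
    smul_smul]

theorem add_nat_mul_period (h : IsAngleLift Ψ Φ) {T : ℝ}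
    (h_period : ∀ t : ℝ, Ψ (t + T) = Ψ t * Ψ T) (t s : ℝ) (k : ℕ) :
    Φ (t + k * T) s = Φ t ((Φ T)^[k] s) := by
  induction k generalizing s with
  | zero => simp
  | succ k ih =>
    rw [Function.iterate_succ_apply, ← ih, ← h.add_period h_period]
    congr 1
    push_cast
    ring

theorem conjMatrix_mulVec_dirVec (s : ℝ) : conjMatrix.mulVec (dirVec s) = dirVec (-s) := by
  apply plane_ext <;> simp [conjMatrix, Matrix.mulVec, dotProduct]

/-- The reflection `conjMatrix` negates angles, so conjugating by it replaces `Φ t` by s ↦ -Φ t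
(-s). -/
theorem neg_apply (h : IsAngleLift Ψ Φ)
    (h_symm : ∀ t : ℝ,
      (Ψ (-t) : Matrix (Fin 1 ⊕ Fin 1) (Fin 1 ⊕ Fin 1) ℝ) =
        conjMatrix * (Ψ t : Matrix (Fin 1 ⊕ Fin 1) (Fin 1 ⊕ Fin 1) ℝ) * conjMatrix)
    (t s : ℝ) : Φ (-t) s = -Φ t (-s) := by
  refine angle_unique (f := fun t => Φ (-t) s) ((h.continuous_left s).comp (by fun_prop))
    (h.continuous_left _).neg (fun t => ?_) (x := 0) (by simp [h.zero]) t
  obtain ⟨r, hr, h₁⟩ := h.image (-t) s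
  obtain ⟨r₂, hr₂, h₂⟩ := h.image t (-s)
  refine sin_sub_eq_zero_of_smul_eq hr.ne' hr₂.ne' ?_
  rw [← h₁, h_symm, ← Matrix.mulVec_mulVec, ← Matrix.mulVec_mulVec, conjMatrix_mulVec_dirVec, h₂,
    Matrix.mulVec_smul, conjMatrix_mulVec_dirVec, Pi.neg_apply]

/-- If a property of angles, indexed by the number of half periods, is preserved by the two maps
from one half period to the next, then it holds at all multiples of the half period. -/
theorem half_period_induction (h : IsAngleLift Ψ Φ) {T : ℝ}
    (h_period : ∀ t : ℝ, Ψ (t + T) = Ψ t * Ψ T)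
    (h_symm : ∀ t : ℝ,
      (Ψ (-t) : Matrix (Fin 1 ⊕ Fin 1) (Fin 1 ⊕ Fin 1) ℝ) =
        conjMatrix * (Ψ t : Matrix (Fin 1 ⊕ Fin 1) (Fin 1 ⊕ Fin 1) ℝ) * conjMatrix)
    (P : ℕ → ℝ → Prop) (h_zero : P 0 0)
    (h_fwd : ∀ n x, P n x → P (n + 1) (Φ (T / 2) x))
    (h_bwd : ∀ n x, P n (-Φ (T / 2) (-x)) → P (n + 1) x) (m : ℕ) : P m (Φ (m * T / 2) 0) := by
  have even (k : ℕ) : Φ ((2 * k : ℕ) * T / 2) 0 = (Φ T)^[k] 0 := by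
    rw [← h.zero ((Φ T)^[k] 0), ← h.add_nat_mul_period h_period]
    congr 1
    push_cast
    ring
  have odd (k : ℕ) : Φ ((2 * k + 1 : ℕ) * T / 2) 0 = Φ (T / 2) ((Φ T)^[k] 0) := by
    rw [← h.add_nat_mul_period h_period]
    congr 1
    push_cast
    ring
  have main (k : ℕ) : P (2 * k) ((Φ T)^[k] 0) := by
    induction k with
    | zero => exact h_zero
    | succ k ih =>
      -- With x = `Φ T y`, the angle -Φ (T/2) (-x) is Φ (-T/2) (Φ T y) = Φ (T/2) y, the preceding
      -- odd stage.
      refine h_bwd (2 * k + 1) _ ?_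
      rw [Function.iterate_succ_apply', ← h.neg_apply h_symm, ← h.add_period h_period,
        show -(T / 2) + T = T / 2 by ring]
      exact h_fwd _ _ ih
  obtain ⟨k, rfl | rfl⟩ := m.even_or_odd'
  · rw [even]
    exact main k
  · rw [odd]
    exact h_fwd _ _ (main k)

/-- With g = `Φ (T / 2)`: x ≥ nπ gives g(x) ≥ g(0) + nπ > (n + 1)π, while x ≤ (n + 1)π gives -g(-x)
≤ (n + 1)π - g(0) < nπ. -/
theorem nat_mul_pi_lt (h : IsAngleLift Ψ Φ) {T : ℝ}
    (h_period : ∀ t : ℝ, Ψ (t + T) = Ψ t * Ψ T)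
    (h_symm : ∀ t : ℝ,
      (Ψ (-t) : Matrix (Fin 1 ⊕ Fin 1) (Fin 1 ⊕ Fin 1) ℝ) =
        conjMatrix * (Ψ t : Matrix (Fin 1 ⊕ Fin 1) (Fin 1 ⊕ Fin 1) ℝ) * conjMatrix)
    (hα : π < Φ (T / 2) 0) {m : ℕ} (hm : 1 ≤ m) :
    m * π < Φ (m * T / 2) 0 := by
  -- The start is the angle 0 itself, so strictness can only be claimed from n = 1 on.
  have key := h.half_period_induction h_period h_symm
    (fun n x => (n : ℝ) * π ≤ x ∧ (1 ≤ n → (n : ℝ) * π < x)) (by simp) ?_ ?_ m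
  · exact key.2 hm
  · rintro n x ⟨hx, -⟩
    have h₁ := (h.strictMono (T / 2)).monotone hx
    have h₂ := h.int_mul_pi (T / 2) n
    rw [Int.cast_natCast] at h₂
    have : ((n + 1 : ℕ) : ℝ) * π < Φ (T / 2) x := by
      push_cast
      linarith
    exact ⟨this.le, fun _ => this⟩
  · rintro n x ⟨hx, -⟩
    have : ((n + 1 : ℕ) : ℝ) * π < x := by
      by_contra! hle
      have h₁ := (h.strictMono (T / 2)).monotone (neg_le_neg hle)
      have h₂ := h.int_mul_pi (T / 2) (-(n + 1 : ℕ))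
      push_cast at h₁ h₂
      rw [neg_mul] at h₂
      linarith
    exact ⟨this.le, fun _ => this⟩

theorem pos_of_half_pos (h : IsAngleLift Ψ Φ) {T : ℝ}
    (h_period : ∀ t : ℝ, Ψ (t + T) = Ψ t * Ψ T)
    (h_symm : ∀ t : ℝ,
      (Ψ (-t) : Matrix (Fin 1 ⊕ Fin 1) (Fin 1 ⊕ Fin 1) ℝ) =
        conjMatrix * (Ψ t : Matrix (Fin 1 ⊕ Fin 1) (Fin 1 ⊕ Fin 1) ℝ) * conjMatrix)
    (hα : 0 < Φ (T / 2) 0) {m : ℕ} (hm : 1 ≤ m) : 0 < Φ (m * T / 2) 0 := by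
  have key := h.half_period_induction h_period h_symm
    (fun n x => 0 ≤ x ∧ (1 ≤ n → 0 < x)) (by simp) ?_ ?_ m
  · exact key.2 hm
  · rintro n x ⟨hx, -⟩
    have : 0 < Φ (T / 2) x := hα.trans_le ((h.strictMono (T / 2)).monotone hx)
    exact ⟨this.le, fun _ => this⟩
  · rintro n x ⟨hx, -⟩
    have : 0 < x := by
      by_contra! hle
      have := (h.strictMono (T / 2)).monotone (neg_nonneg.2 hle)
      linarith
    exact ⟨this.le, fun _ => this⟩

theorem nonpos_of_half_nonpos (h : IsAngleLift Ψ Φ) {T : ℝ}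
    (h_period : ∀ t : ℝ, Ψ (t + T) = Ψ t * Ψ T)
    (h_symm : ∀ t : ℝ,
      (Ψ (-t) : Matrix (Fin 1 ⊕ Fin 1) (Fin 1 ⊕ Fin 1) ℝ) =
        conjMatrix * (Ψ t : Matrix (Fin 1 ⊕ Fin 1) (Fin 1 ⊕ Fin 1) ℝ) * conjMatrix)
    (hα : Φ (T / 2) 0 ≤ 0) (m : ℕ) : Φ (m * T / 2) 0 ≤ 0 := by
  refine h.half_period_induction h_period h_symm (fun _ x => x ≤ 0) le_rfl ?_ ?_ m
  · intro n x hx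
    exact ((h.strictMono (T / 2)).monotone hx).trans hα
  · intro n x hx
    by_contra! hlt
    have := h.strictMono (T / 2) (neg_neg_iff_pos.2 hlt)
    linarith

end IsAngleLift

/-! ### Signs near a zero and the half-turn count -/

theorem mem_realAxis_iff {v : Plane} : v ∈ realAxis ↔ v (Sum.inr 0) = 0 := by
  rw [realAxis, Submodule.mem_span_singleton]
  constructor
  · rintro ⟨c, rfl⟩
    simp
  · intro h
    exact ⟨v (Sum.inl 0), plane_ext (by simp) (by simp [h])⟩

theorem smul_dirVec_mem_realAxis_iff {r θ : ℝ} (hr : r ≠ 0) :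
    r • dirVec θ ∈ realAxis ↔ sin θ = 0 := by
  simp [mem_realAxis_iff, hr]

theorem real_sign_mul (x y : ℝ) : Real.sign (x * y) = Real.sign x * Real.sign y := by
  rcases lt_trichotomy x 0 with hx | rfl | hx <;> rcases lt_trichotomy y 0 with hy | rfl | hy <;>
    simp [*, Real.sign_of_neg, Real.sign_of_pos, mul_pos_of_neg_of_neg,
      mul_neg_of_neg_of_pos, mul_neg_of_pos_of_neg]

theorem real_sign_eventually_eq {x₀ : ℝ} (h : x₀ ≠ 0) :
    ∀ᶠ x in 𝓝 x₀, Real.sign x = Real.sign x₀ := by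
  rcases h.lt_or_gt with h | h
  · filter_upwards [gt_mem_nhds h] with x hx
    rw [Real.sign_of_neg hx, Real.sign_of_neg h]
  · filter_upwards [lt_mem_nhds h] with x hx
    rw [Real.sign_of_pos hx, Real.sign_of_pos h]

theorem sign_eventually_eq_of_hasDerivWithinAt {f : ℝ → ℝ} {f' t : ℝ} {S : Set ℝ}
    (hf : HasDerivWithinAt f f' S t) (h0 : f t = 0) (hf' : f' ≠ 0) :
    ∀ᶠ s in 𝓝[S] t, Real.sign (f s) = Real.sign f' * Real.sign (s - t) := by
  have h₁ := (hasDerivWithinAt_iff_tendsto_slope.1 hf).eventually (real_sign_eventually_eq hf')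
  rw [eventually_nhdsWithin_iff] at h₁ ⊢
  filter_upwards [h₁] with s hs hsS
  rcases eq_or_ne s t with rfl | hst
  · simp [h0]
  · rw [← hs ⟨hsS, hst⟩, ← real_sign_mul, slope_def_field, h0, sub_zero,
      div_mul_cancel₀ _ (sub_ne_zero.2 hst)]

/-- The index of a path of lines with initial angle `0` and final angle `θ`: the mean of the
floor and the ceiling of `θ / π`. -/
noncomputable def halfTurns (θ : ℝ) : ℝ := ((⌊θ / π⌋ : ℝ) + ⌈θ / π⌉) / 2

theorem halfTurns_int_mul_pi (k : ℤ) : halfTurns (k * π) = k := by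
  rw [halfTurns, mul_div_cancel_right₀ _ pi_ne_zero, Int.floor_intCast, Int.ceil_intCast]
  ring

theorem halfTurns_of_mem_Ioo {k : ℤ} {θ : ℝ} (h₁ : k * π < θ) (h₂ : θ < (k + 1) * π) :
    halfTurns θ = k + 1 / 2 := by
  have hf : ⌊θ / π⌋ = k :=
    Int.floor_eq_iff.2 ⟨((lt_div_iff₀ pi_pos).2 h₁).le, (div_lt_iff₀ pi_pos).2 h₂⟩
  have hc : ⌈θ / π⌉ = k + 1 := by
    rw [Int.ceil_eq_iff]
    push_cast
    exact ⟨by simpa using (lt_div_iff₀ pi_pos).2 h₁, ((div_lt_iff₀ pi_pos).2 h₂).le⟩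
  rw [halfTurns, hf, hc]
  push_cast
  ring

theorem halfTurns_eventually_eq {θ₀ : ℝ} (h : sin θ₀ ≠ 0) :
    ∀ᶠ θ in 𝓝 θ₀, halfTurns θ = halfTurns θ₀ := by
  have h₁ : (⌊θ₀ / π⌋ : ℝ) * π < θ₀ := by
    refine lt_of_le_of_ne ((le_div_iff₀ pi_pos).1 (Int.floor_le _)) fun he => h ?_
    rw [← he, sin_int_mul_pi]
  have h₂ : θ₀ < (⌊θ₀ / π⌋ + 1) * π := (div_lt_iff₀ pi_pos).1 (Int.lt_floor_add_one _)
  filter_upwards [Ioo_mem_nhds h₁ h₂] with θ hθ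
  rw [halfTurns_of_mem_Ioo hθ.1 hθ.2, halfTurns_of_mem_Ioo h₁ h₂]

/-- Below, at and above kπ the count is k - 1/2, k, k + 1/2. Writing the jump as a sign lets it be
compared with that of a crossing form. -/
theorem halfTurns_eventually_eq_sign (k : ℤ) :
    ∀ᶠ θ in 𝓝 (k * π), halfTurns θ = k + Real.sign ((-1) ^ k * sin θ) / 2 := by
  have hπ := pi_pos
  filter_upwards [Ioo_mem_nhds (show (k - 1) * π < k * π by linarith)
    (show k * π < (k + 1) * π by linarith)] with θ hθ
  rw [← sin_sub_int_mul_pi]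
  rcases lt_trichotomy θ (k * π) with h | rfl | h
  · rw [halfTurns_of_mem_Ioo (k := k - 1) (by push_cast; exact hθ.1) (by simpa using h),
      Real.sign_of_neg (sin_neg_of_neg_of_neg_pi_lt (by linarith) (by linarith [hθ.1]))]
    push_cast
    ring
  · simp [halfTurns_int_mul_pi]
  · rw [halfTurns_of_mem_Ioo h hθ.2,
      Real.sign_of_pos (sin_pos_of_pos_of_lt_pi (by linarith) (by linarith [hθ.2]))]

theorem eq_of_eventually_eq_nhdsWithin {f : ℝ → ℝ} {a b : ℝ} (hab : a ≤ b)
    (h : ∀ t ∈ Icc a b, ∀ᶠ s in 𝓝[Icc a b] t, f s = f t) : f b = f a := by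
  have hd : ∀ t ∈ Icc a b, HasDerivWithinAt f 0 (Icc a b) t := fun t ht =>
    (hasDerivWithinAt_const t (Icc a b) (f t)).congr_of_eventuallyEq (h t ht) rfl
  refine constant_of_derivWithin_zero (fun t ht => (hd t ht).differentiableWithinAt)
    (fun t ht => ?_) b (right_mem_Icc.2 hab)
  have hab' : a < b := ht.1.trans_lt ht.2
  exact (hd t (Ico_subset_Icc_self ht)).derivWithin
    (uniqueDiffOn_Icc hab' t (Ico_subset_Icc_self ht))

/-! ### The crossing sum as a difference of half-turn counts -/

section CrossingSum

variable {u : ℝ → Plane} {a b : ℝ}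

/-- Near a regular crossing with the real axis, the imaginary part changes sign according to the
crossing form. -/
theorem HasRegularCrossings.sign_eventually_eq (hu : HasRegularCrossings u realAxis a b)
    {t : ℝ} (ht : t ∈ Icc a b) (hmem : u t ∈ realAxis) :
    ∀ᶠ s in 𝓝[Icc a b] t, Real.sign (u t (Sum.inl 0)) * Real.sign (u s (Sum.inr 0)) =
      Real.sign (crossingForm u a b t) * Real.sign (s - t) := by
  have hd : HasDerivWithinAt u (derivWithin u (Icc a b) t) (Icc a b) t :=
    ((hu.1.differentiableOn one_ne_zero) t ht).hasDerivWithinAt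
  have hy := hasDerivWithinAt_pi.1 hd (Sum.inr 0)
  have h0 := mem_realAxis_iff.1 hmem
  have hform : crossingForm u a b t =
      u t (Sum.inl 0) * derivWithin u (Icc a b) t (Sum.inr 0) := by
    rw [crossingForm, omega, h0]
    ring
  have hne := hu.2.2 t ht hmem
  rw [hform] at hne ⊢
  filter_upwards [sign_eventually_eq_of_hasDerivWithinAt hy h0 (right_ne_zero_of_mul hne)]
    with s hs
  rw [hs, real_sign_mul, mul_assoc]

/-- Infinitely many crossings would accumulate at some t in the compact interval. If t is a
crossing, regularity isolates it; otherwise continuity keeps crossings away. -/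
theorem HasRegularCrossings.finite (hu : HasRegularCrossings u realAxis a b) :
    {t : ℝ | t ∈ Icc a b ∧ u t ∈ realAxis}.Finite := by
  have hy : ContinuousOn (fun t => u t (Sum.inr 0)) (Icc a b) :=
    (continuous_apply _).comp_continuousOn hu.1.continuousOn
  by_contra hinf
  obtain ⟨t, ht, hacc⟩ :=
    Set.Infinite.exists_accPt_of_subset_isCompact hinf isCompact_Icc (sep_subset _ _)
  rw [accPt_iff_frequently] at hacc
  refine hacc ?_
  by_cases htZ : u t ∈ realAxis
  · filter_upwards [eventually_nhdsWithin_iff.1 (hu.sign_eventually_eq ht htZ)] with s hs hsZ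
    have h := hs hsZ.2.1
    rw [mem_realAxis_iff.1 hsZ.2.2, Real.sign_zero, mul_zero, eq_comm, mul_eq_zero,
      Real.sign_eq_zero_iff, Real.sign_eq_zero_iff, sub_eq_zero] at h
    exact h.elim (hu.2.2 t ht htZ) hsZ.1
  · filter_upwards [eventually_nhdsWithin_iff.1
      ((hy t ht).eventually_ne (mt mem_realAxis_iff.2 htZ))] with s hs hsZ
    exact hs hsZ.2.1 (mem_realAxis_iff.1 hsZ.2.2)

/-- The crossing sum of a path with regular crossings with the real axis is determined by its
angles at the ends. -/
theorem HasRegularCrossings.crossingSum_eq (hu : HasRegularCrossings u realAxis a b) (hab : a < b)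
    {θ : ℝ → ℝ} (hθ : ContinuousOn θ (Icc a b))
    (huθ : ∀ t ∈ Icc a b, ∃ r : ℝ, 0 < r ∧ u t = r • dirVec (θ t)) :
    crossingSum u realAxis a b = halfTurns (θ b) - halfTurns (θ a) := by
  classical
  set Z := {t : ℝ | t ∈ Icc a b ∧ u t ∈ realAxis} with hZ
  have hfin : Z.Finite := hu.finite
  set σ : ℝ → ℝ := fun t => Real.sign (crossingForm u a b t)
  -- Each crossing contributes a step of height σ z taking its middle value at z. An interior step
  -- is traversed fully and an end one by half, which is the factor 1/2 in the crossing sum.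
  set F : ℝ → ℝ := fun t => ∑ z ∈ hfin.toFinset, σ z * (Real.sign (t - z) / 2)
  have hsum : crossingSum u realAxis a b = F b - F a := by
    rw [crossingSum, finsum_mem_eq_finite_toFinset_sum _ hfin, ← Finset.sum_sub_distrib]
    refine Finset.sum_congr rfl fun z hz => ?_
    have hzI : z ∈ Icc a b := ((hfin.mem_toFinset).1 hz).1
    rcases hzI.1.eq_or_lt with rfl | haz
    · rw [if_pos (Or.inl rfl), sub_self, Real.sign_zero, Real.sign_of_pos (sub_pos.2 hab)]
      ring
    · rcases hzI.2.eq_or_lt with rfl | hzb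
      · rw [if_pos (Or.inr rfl), sub_self, Real.sign_zero, Real.sign_of_neg (sub_neg.2 hab)]
        ring
      · rw [if_neg (by rintro (rfl | rfl) <;> simp at *), Real.sign_of_neg (sub_neg.2 haz),
          Real.sign_of_pos (sub_pos.2 hzb)]
        ring
  -- The two functions have the same jumps, so their difference is locally constant.
  have hconst : halfTurns (θ b) - F b = halfTurns (θ a) - F a := by
    refine eq_of_eventually_eq_nhdsWithin (f := fun t => halfTurns (θ t) - F t) hab.le
      fun t ht => ?_
    have hother : ∀ z, z ≠ t → ∀ᶠ s in 𝓝[Icc a b] t, Real.sign (s - z) = Real.sign (t - z) :=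
      fun z hz => ((((continuous_id.sub continuous_const).tendsto t).eventually
        (real_sign_eventually_eq (sub_ne_zero.2 hz.symm))).filter_mono nhdsWithin_le_nhds)
    obtain ⟨r, hr, hut⟩ := huθ t ht
    by_cases htZ : u t ∈ realAxis
    · have hall : ∀ᶠ s in 𝓝[Icc a b] t, ∀ z ∈ hfin.toFinset.erase t,
          Real.sign (s - z) = Real.sign (t - z) :=
        (Finset.eventually_all _).2 fun z hz => hother z (Finset.ne_of_mem_erase hz)
      have hsin : sin (θ t) = 0 := by rwa [hut, smul_dirVec_mem_realAxis_iff hr.ne'] at htZ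
      obtain ⟨k, hk⟩ := sin_eq_zero_iff.1 hsin
      have hF (s : ℝ) : F s = σ t * (Real.sign (s - t) / 2) +
          ∑ z ∈ hfin.toFinset.erase t, σ z * (Real.sign (s - z) / 2) :=
        (Finset.add_sum_erase _ _ (hfin.mem_toFinset.2 ⟨ht, htZ⟩)).symm
      have hev := (hθ t ht).eventually (hk ▸ halfTurns_eventually_eq_sign k)
      filter_upwards [hall, hev, hu.sign_eventually_eq ht htZ, self_mem_nhdsWithin]
        with s hs₁ hs₂ hs₃ hsI
      obtain ⟨r', hr', hus⟩ := huθ s hsI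
      rw [hF, hF, Finset.sum_congr rfl fun z hz => by rw [hs₁ z hz], hs₂, ← hk,
        halfTurns_int_mul_pi, real_sign_mul]
      rw [hut, hus] at hs₃
      simp only [Pi.smul_apply, dirVec_inl, dirVec_inr, smul_eq_mul, real_sign_mul,
        Real.sign_of_pos hr, Real.sign_of_pos hr', one_mul, ← hk, cos_int_mul_pi] at hs₃
      rw [hs₃, sub_self, Real.sign_zero]
      ring
    · have hsin : sin (θ t) ≠ 0 := by rwa [hut, smul_dirVec_mem_realAxis_iff hr.ne'] at htZ
      have hall : ∀ᶠ s in 𝓝[Icc a b] t, ∀ z ∈ hfin.toFinset,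
          Real.sign (s - z) = Real.sign (t - z) :=
        (Finset.eventually_all _).2 fun z hz => hother z (by
          rintro rfl
          exact htZ (hfin.mem_toFinset.1 hz).2)
      filter_upwards [hall, (hθ t ht).eventually (halfTurns_eventually_eq hsin)] with s hs₁ hs₂
      rw [hs₂]
      congr 1
      exact Finset.sum_congr rfl fun z hz => by rw [hs₁ z hz]
  rw [hsum]
  linarith

end CrossingSum

/-! ### Homotopy invariance and existence of the index -/

/-- The angle of a continuous nowhere vanishing vector field on an interval. -/
theorem exists_angle_Icc {u : ℝ → Plane} {a b : ℝ} (hab : a ≤ b) (hu : ContinuousOn u (Icc a b))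
    (h0 : ∀ t ∈ Icc a b, u t ≠ 0) :
    ∃ θ : ℝ → ℝ, Continuous θ ∧ ∀ t ∈ Icc a b, ∃ r : ℝ, 0 < r ∧ u t = r • dirVec (θ t) := by
  obtain ⟨r, θ₀, hr, h⟩ := exists_polar (h0 a (left_mem_Icc.2 hab))
  obtain ⟨θ, hθ, -, hθu⟩ := exists_angle (u := fun t : ℝ => u (projIcc a b hab t))
    (hu.domRestrict.comp continuous_projIcc) (fun t => h0 _ (projIcc a b hab t).2) a hr
    (by rw [projIcc_left]; exact h)
  refine ⟨θ, hθ, fun t ht => ?_⟩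
  have := hθu t
  rwa [projIcc_of_mem hab ht] at this

/-- The angle of a continuous nowhere vanishing vector field on a rectangle. -/
theorem exists_angle_rectangle {u : ℝ × ℝ → Plane} {a b : ℝ} (hab : a ≤ b)
    (hu : ContinuousOn u (Icc 0 1 ×ˢ Icc a b)) (h0 : ∀ p ∈ Icc (0 : ℝ) 1 ×ˢ Icc a b, u p ≠ 0) :
    ∃ θ : ℝ × ℝ → ℝ, Continuous θ ∧
      ∀ p ∈ Icc (0 : ℝ) 1 ×ˢ Icc a b, ∃ r : ℝ, 0 < r ∧ u p = r • dirVec (θ p) := by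
  set ρ : ℝ × ℝ → ℝ × ℝ := fun p => (projIcc (0 : ℝ) 1 zero_le_one p.1, projIcc a b hab p.2)
  have hρ : Continuous ρ :=
    (continuous_subtype_val.comp (continuous_projIcc.comp continuous_fst)).prodMk
      (continuous_subtype_val.comp (continuous_projIcc.comp continuous_snd))
  have hmem (p) : ρ p ∈ Icc (0 : ℝ) 1 ×ˢ Icc a b := ⟨Subtype.prop _, Subtype.prop _⟩
  obtain ⟨r, θ₀, hr, h⟩ := exists_polar (h0 _ (hmem 0))
  obtain ⟨θ, hθ, -, hθu⟩ := exists_angle (u := fun p => u (ρ p))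
    (hu.comp_continuous hρ hmem) (fun p => h0 _ (hmem p)) 0 hr h
  refine ⟨θ, hθ, fun p hp => ?_⟩
  have hp' : ρ p = p := by simp [ρ, projIcc_of_mem _ hp.1, projIcc_of_mem _ hp.2]
  have := hθu p
  rwa [hp'] at this

variable {Λ : ℝ → Submodule ℝ Plane} {b : ℝ} {θ : ℝ → ℝ}

theorem halfTurns_add_int_mul_pi (x : ℝ) (k : ℤ) : halfTurns (x + k * π) = halfTurns x + k := by
  rw [halfTurns, halfTurns, add_div x, mul_div_cancel_right₀ _ pi_ne_zero, Int.floor_add_intCast,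
    Int.ceil_add_intCast]
  push_cast
  ring

/-- Every Robbin-Salamon index of a path of lines is given by its angles at the ends. -/
theorem IsRSIndex.eq_halfTurns {a μ : ℝ} (h : IsRSIndex Λ realAxis a b μ) (hab : a < b)
    (hθ : ContinuousOn θ (Icc a b))
    (hΛ : ∀ t ∈ Icc a b, Λ t = Submodule.span ℝ {dirVec (θ t)}) (ha : θ a = 0) :
    μ = halfTurns (θ b) := by
  obtain ⟨u, hu, ⟨H, ⟨w, hw, hwH⟩, hH₀₁, hHab⟩, rfl⟩ := h
  simp only at hH₀₁
  obtain ⟨ϑ, hϑ, hϑu⟩ := exists_angle_Icc hab.le hu.1.continuousOn hu.2.1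
  obtain ⟨W, hW, hWw⟩ := exists_angle_rectangle hab.le hw fun p hp => (hwH p hp).1
  have hHW : ∀ p ∈ Icc (0 : ℝ) 1 ×ˢ Icc a b, H p = Submodule.span ℝ {dirVec (W p)} := by
    intro p hp
    obtain ⟨r, hr, hrw⟩ := hWw p hp
    rw [(hwH p hp).2, hrw, span_smul_dirVec hr]
  have ha' := left_mem_Icc.2 hab.le
  have hb' := right_mem_Icc.2 hab.le
  have h0' : (0 : ℝ) ∈ Icc (0 : ℝ) 1 := left_mem_Icc.2 zero_le_one
  have h1' : (1 : ℝ) ∈ Icc (0 : ℝ) 1 := right_mem_Icc.2 zero_le_one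
  -- Compare the angle W along the four sides of the rectangle: the two paths turn by the same
  -- amount, since W is constant on the sides where the end lines are fixed.
  have left_side : W (0, a) - θ a = W (0, b) - θ b :=
    angle_sub_const (f := fun t => W (0, t)) isPreconnected_Icc (by fun_prop) hθ
      (fun t ht => span_dirVec_eq_iff.1 (by
        rw [← hHW _ ⟨h0', ht⟩, ← hΛ t ht, (hH₀₁ t ht).1])) ha' hb'
  have right_side : W (1, a) - ϑ a = W (1, b) - ϑ b :=
    angle_sub_const (f := fun t => W (1, t)) isPreconnected_Icc (by fun_prop) hϑ.continuousOn
      (fun t ht => span_dirVec_eq_iff.1 (by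
        obtain ⟨r, hr, hru⟩ := hϑu t ht
        rw [← hHW _ ⟨h1', ht⟩, (hH₀₁ t ht).2, hru, span_smul_dirVec hr])) ha' hb'
  have horizontal : ∀ c ∈ Icc a b, (∀ s ∈ Icc (0 : ℝ) 1, H (s, c) = Λ c) →
      W (0, c) = W (1, c) := by
    intro c hc hHc
    have := angle_sub_const (f := fun s => W (s, c)) (g := fun _ => θ c)
      (isPreconnected_Icc (a := (0 : ℝ)) (b := 1)) (by fun_prop) continuousOn_const
      (fun s hs => span_dirVec_eq_iff.1 (by rw [← hHW _ ⟨hs, hc⟩, hHc s hs, hΛ c hc])) h0' h1'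
    linarith
  have bottom := horizontal a ha' fun s hs => (hHab s hs).1
  have top := horizontal b hb' fun s hs => (hHab s hs).2
  obtain ⟨k, hk⟩ : ∃ k : ℤ, ϑ a = θ a + k * π := by
    apply exists_int_of_sin_sub_eq_zero
    obtain ⟨r, hr, hru⟩ := hϑu a ha'
    rw [← span_dirVec_eq_iff, ← hΛ a ha', ← (hHab 1 h1').1, (hH₀₁ a ha').2, hru,
      span_smul_dirVec hr]
  have hkb : ϑ b = θ b + k * π := by linarith
  rw [hu.crossingSum_eq hab hϑ.continuousOn hϑu, hk, hkb, halfTurns_add_int_mul_pi,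
    halfTurns_add_int_mul_pi, ha]
  simp [halfTurns]

theorem crossingForm_dirVec {a t : ℝ} {ϑ : ℝ → ℝ} {ϑ' : ℝ} (h : HasDerivAt ϑ ϑ' t) (hab : a < b)
    (ht : t ∈ Icc a b) : crossingForm (fun s => dirVec (ϑ s)) a b t = ϑ' := by
  have hd : HasDerivAt (fun s => dirVec (ϑ s))
      (Sum.elim (fun _ => -sin (ϑ t) * ϑ') fun _ => cos (ϑ t) * ϑ') t := by
    rw [hasDerivAt_pi]
    rintro (i | i)
    · exact h.cos
    · exact h.sin
  rw [crossingForm, hd.hasDerivWithinAt.derivWithin (uniqueDiffOn_Icc hab t ht), omega]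
  simp only [dirVec_inl, dirVec_inr, Sum.elim_inl, Sum.elim_inr]
  linear_combination ϑ' * sin_sq_add_cos_sq (ϑ t)

/-- A path of lines is homotopic with fixed ends to one with regular crossings. -/
theorem exists_isRSIndex (hb : 0 < b) (hθ : ContinuousOn θ (Icc 0 b))
    (hΛ : ∀ t ∈ Icc 0 b, Λ t = Submodule.span ℝ {dirVec (θ t)}) (h0 : θ 0 = 0) :
    ∃ μ, IsRSIndex Λ realAxis 0 b μ := by
  obtain ⟨ϑ, hϑ, hϑ0, hϑb, hreg⟩ : ∃ ϑ : ℝ → ℝ, ContDiff ℝ 1 ϑ ∧ ϑ 0 = 0 ∧ ϑ b = θ b ∧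
      ∀ t ∈ Icc 0 b, sin (ϑ t) = 0 → ∃ d, d ≠ 0 ∧ HasDerivAt ϑ d t := by
    rcases eq_or_ne (θ b) 0 with h | h
    -- A constant angle 0 would give degenerate crossings. This bump returns to 0, stays below π,
    -- and meets the axis only at the ends, with nonzero slope.
    · refine ⟨fun t => t * (b - t) / b ^ 2, by fun_prop, by simp, by simp [h], fun t ht hs => ?_⟩
      have h₁ : 0 ≤ t * (b - t) / b ^ 2 :=
        div_nonneg (mul_nonneg ht.1 (sub_nonneg.2 ht.2)) (sq_nonneg b)
      have h₂ : t * (b - t) / b ^ 2 ≤ 1 := by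
        rw [div_le_one (by positivity)]
        nlinarith [ht.1, ht.2, sq_nonneg t]
      have h₃ : t * (b - t) / b ^ 2 = 0 :=
        (sin_eq_zero_iff_of_lt_of_lt (by linarith [pi_pos]) (by linarith [pi_gt_three])).1 hs
      have hd : HasDerivAt (fun t => t * (b - t) / b ^ 2) ((1 * (b - t) + t * (-1)) / b ^ 2) t :=
        ((hasDerivAt_id t).mul ((hasDerivAt_id t).const_sub b)).div_const _
      refine ⟨_, ?_, hd⟩
      rw [div_eq_zero_iff, mul_eq_zero, sub_eq_zero] at h₃
      apply div_ne_zero _ (by positivity)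
      rcases h₃ with (rfl | rfl) | h₃
      · simpa using hb.ne'
      · simpa using hb.ne'
      · exact absurd h₃ (by positivity)
    · refine ⟨fun t => t * (θ b / b), by fun_prop, by simp, mul_div_cancel₀ _ hb.ne', fun t _ _ =>
        ⟨θ b / b, div_ne_zero h hb.ne', by simpa using (hasDerivAt_id t).mul_const (θ b / b)⟩⟩
  refine ⟨_, fun t => dirVec (ϑ t), ⟨(contDiff_dirVec.comp hϑ).contDiffOn,
    fun t _ => dirVec_ne_zero _, fun t ht hmem => ?_⟩,
    -- Interpolate the angles linearly; the ends stay fixed because θ and ϑ agree there.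
    ⟨fun p => Submodule.span ℝ {dirVec ((1 - p.1) * θ p.2 + p.1 * ϑ p.2)},
      ⟨_, ?_, fun p _ => ⟨dirVec_ne_zero _, rfl⟩⟩, fun t ht => ?_, fun s _ => ?_⟩, rfl⟩
  · obtain ⟨d, hd, hϑd⟩ := hreg t ht (mem_realAxis_iff.1 hmem)
    rwa [crossingForm_dirVec hϑd hb ht]
  · have h₁ : ContinuousOn (fun p : ℝ × ℝ => θ p.2) (Icc 0 1 ×ˢ Icc 0 b) :=
      hθ.comp continuousOn_snd fun p hp => hp.2
    have h₂ : Continuous fun p : ℝ × ℝ => ϑ p.2 := hϑ.continuous.comp continuous_snd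
    exact continuous_dirVec.comp_continuousOn
      (((continuousOn_const.sub continuousOn_fst).mul h₁).add (continuousOn_fst.mul h₂.continuousOn))
  · simp [hΛ t ht]
  · rw [hΛ 0 (left_mem_Icc.2 hb.le), hΛ b (right_mem_Icc.2 hb.le)]
    simp only [hϑ0, hϑb, h0]
    constructor <;> ring_nf

/-- The Robbin-Salamon index of a path of lines that starts at the real axis is determined by its
final angle. -/
theorem rsIndex_eq_halfTurns (hb : 0 < b) (hθ : ContinuousOn θ (Icc 0 b))
    (hΛ : ∀ t ∈ Icc 0 b, Λ t = Submodule.span ℝ {dirVec (θ t)}) (h0 : θ 0 = 0) :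
    rsIndex Λ realAxis 0 b = halfTurns (θ b) := by
  have h := exists_isRSIndex hb hθ hΛ h0
  rw [rsIndex, dif_pos h]
  exact h.choose_spec.eq_halfTurns hb hθ hΛ h0

/-! ### The index of the moved real axis -/

theorem IsAngleLift.movedLine_realAxis {Ψ : ℝ → Matrix.symplecticGroup (Fin 1) ℝ}
    {Φ : ℝ → ℝ → ℝ} (h : IsAngleLift Ψ Φ) (t : ℝ) :
    movedLine Ψ realAxis t = Submodule.span ℝ {dirVec (Φ t 0)} := by
  obtain ⟨r, hr, hrΨ⟩ := h.image t 0
  have h0 : (Pi.single (Sum.inl 0) 1 : Plane) = dirVec 0 := plane_ext (by simp) (by simp)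
  rw [movedLine, realAxis, Submodule.map_span, image_singleton, Matrix.toLin'_apply, h0, hrΨ,
    span_smul_dirVec hr]

theorem IsAngleLift.rsIndex_eq {Ψ : ℝ → Matrix.symplecticGroup (Fin 1) ℝ}
    {Φ : ℝ → ℝ → ℝ} (h : IsAngleLift Ψ Φ) (hb : 0 < b) :
    rsIndex (movedLine Ψ realAxis) realAxis 0 b = halfTurns (Φ b 0) :=
  rsIndex_eq_halfTurns (θ := fun t => Φ t 0) hb (h.continuous_left 0).continuousOn
    (fun t _ => h.movedLine_realAxis t) (h.zero 0)

/-- If x/π ≤ n, then floor and ceiling are both at most n; if x/π > n, they are at least n and n +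
1. -/
theorem nat_add_half_le_halfTurns_iff {n : ℕ} {x : ℝ} :
    (n : ℝ) + 1 / 2 ≤ halfTurns x ↔ n * π < x := by
  have hx : x / π * π = x := div_mul_cancel₀ _ pi_ne_zero
  constructor
  · intro h
    by_contra! hle
    have h₁ : x / π ≤ n := (div_le_iff₀ pi_pos).2 hle
    have h₂ : (⌊x / π⌋ : ℝ) ≤ n := (Int.floor_le _).trans h₁
    have h₃ : (⌈x / π⌉ : ℝ) ≤ n := by exact_mod_cast Int.ceil_le.2 (by exact_mod_cast h₁)
    rw [halfTurns] at h
    linarith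
  · intro h
    have h₁ : (n : ℝ) < x / π := (lt_div_iff₀ pi_pos).2 h
    have h₂ : (n : ℝ) ≤ ⌊x / π⌋ := by exact_mod_cast Int.le_floor.2 (by exact_mod_cast h₁.le)
    have h₃ : ((n : ℝ) + 1) ≤ ⌈x / π⌉ := by
      have : (n : ℤ) < ⌈x / π⌉ := Int.lt_ceil.2 (by exact_mod_cast h₁)
      exact_mod_cast Int.add_one_le_iff.2 this
    rw [halfTurns]
    linarith

theorem half_le_halfTurns_iff {x : ℝ} : 1 / 2 ≤ halfTurns x ↔ 0 < x := by
  simpa using nat_add_half_le_halfTurns_iff (n := 0) (x := x)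

end RSIndex

theorem mainTheorem8 (T : ℝ) (hT : 0 < T)
    (Ψ : ℝ → Matrix.symplecticGroup (Fin 1) ℝ) (hcont : Continuous Ψ)
    (h_one : Ψ 0 = 1)
    (h_period : ∀ t : ℝ, Ψ (t + T) = Ψ t * Ψ T)
    (h_symm : ∀ t : ℝ,
      (Ψ (-t) : Matrix (Fin 1 ⊕ Fin 1) (Fin 1 ⊕ Fin 1) ℝ) =
        RSIndex.conjMatrix * (Ψ t : Matrix (Fin 1 ⊕ Fin 1) (Fin 1 ⊕ Fin 1) ℝ) *
          RSIndex.conjMatrix) :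
    (3 / 2 ≤ RSIndex.rsIndex (RSIndex.movedLine Ψ RSIndex.realAxis) RSIndex.realAxis 0 (T / 2) →
      ∀ m : ℕ, 1 ≤ m →
        (2 * (m : ℝ) + 1) / 2 ≤
          RSIndex.rsIndex (RSIndex.movedLine Ψ RSIndex.realAxis) RSIndex.realAxis
            0 ((m : ℝ) * T / 2)) ∧
    (1 / 2 ≤ RSIndex.rsIndex (RSIndex.movedLine Ψ RSIndex.realAxis) RSIndex.realAxis 0 (T / 2) →
      ∀ m : ℕ, 1 ≤ m →
        1 / 2 ≤
          RSIndex.rsIndex (RSIndex.movedLine Ψ RSIndex.realAxis) RSIndex.realAxis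
            0 ((m : ℝ) * T / 2)) ∧
    (RSIndex.rsIndex (RSIndex.movedLine Ψ RSIndex.realAxis) RSIndex.realAxis 0 (T / 2) < 1 / 2 →
      ∀ m : ℕ, 1 ≤ m →
        RSIndex.rsIndex (RSIndex.movedLine Ψ RSIndex.realAxis) RSIndex.realAxis
            0 ((m : ℝ) * T / 2) < 1 / 2) := by
  obtain ⟨Φ, h⟩ := RSIndex.exists_angleLift hcont h_one
  have index (m : ℕ) (hm : 1 ≤ m) :
      RSIndex.rsIndex (RSIndex.movedLine Ψ RSIndex.realAxis) RSIndex.realAxis 0 ((m : ℝ) * T / 2) =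
        RSIndex.halfTurns (Φ (m * T / 2) 0) :=
    h.rsIndex_eq (div_pos (mul_pos (Nat.cast_pos.2 hm) hT) two_pos)
  rw [h.rsIndex_eq (half_pos hT), RSIndex.half_le_halfTurns_iff]
  refine ⟨fun hα m hm => ?_, fun hα m hm => ?_, fun hα m hm => ?_⟩
  · rw [index m hm, add_div, mul_div_cancel_left₀ _ two_ne_zero,
      RSIndex.nat_add_half_le_halfTurns_iff]
    refine h.nat_mul_pi_lt h_period h_symm ?_ hm
    -- The hypothesis 3/2 ≤ index is the case n = 1, that is, a half-period angle beyond π.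
    have : ((1 : ℕ) : ℝ) + 1 / 2 ≤ RSIndex.halfTurns (Φ (T / 2) 0) := by
      norm_num
      exact hα
    simpa using RSIndex.nat_add_half_le_halfTurns_iff.1 this
  · rw [index m hm, RSIndex.half_le_halfTurns_iff]
    exact h.pos_of_half_pos h_period h_symm hα hm
  · rw [index m hm]
    rw [← not_le, RSIndex.half_le_halfTurns_iff, not_lt] at hα ⊢
    exact h.nonpos_of_half_nonpos h_period h_symm hα m
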